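/- Let $K$ be a commutative ring which is a reduced $\mathbb{Q}$-algebra, let $n,m\ge 0$ be integers and put $s:=2n+m$; assume $s\ge 1$. Let $A_n$ be the $n$-th Weyl algebra over $K$, i.e. the associative unital $K$-algebra generated by $q_1,\dots,q_n,p_1,\dots,p_n$ subject to the relations $[p_i,q_j]=\delta_{ij}$ and $[p_i,p_j]=[q_i,q_j]=0$, and let $P_m=K[x_{2n+1},\dots,x_{2n+m}]$ be the polynomial algebra in $m$ variables. Write $x_i:=q_i$ and $x_{n+i}:=p_i$ for $1\le i\le n$, so that $x_1,\dots,x_s$ are the canonical generators of $A_n\otimes_K P_m$ and the ordered monomials $x^\alpha:=x_1^{\alpha_1}\cdots x_s^{\alpha_s}$, $\alpha\in\mathbb{N}^s$, form a $K$-basis of it. For $a=\sum_\alpha\lambda_\alpha x^\alpha\in A_n\otimes_K P_m$ put $\deg a:=\max\{\alpha_1+\cdots+\alpha_s \mid \lambda_\alpha\neq 0\}$ (with $\deg 0:=0$), and for a $K$-algebra automorphism $\sigma$ of $A_n\otimes_K P_m$ put $\deg\sigma:=\max\{\deg\sigma(x_i)\mid 1\le i\le s\}$. Then every $K$-algebra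 automorphism $\sigma$ of $A_n\otimes_K P_m$ satisfies $$\deg\sigma^{-1}\le(\deg\sigma)^{s-1}.$$ -/

import Mathlib

open scoped TensorProduct

/-- The defining relations of the `n`-th Weyl algebra, imposed on the free algebra on
`q₁, …, qₙ` (`Sum.inl`) and `p₁, …, pₙ` (`Sum.inr`). -/
inductive WeylAlgebra.Rel (K : Type*) [CommRing K] (n : ℕ) :
    FreeAlgebra K (Fin n ⊕ Fin n) → FreeAlgebra K (Fin n ⊕ Fin n) → Prop
  | qq (i j : Fin n) : WeylAlgebra.Rel K n
      (FreeAlgebra.ι K (Sum.inl i) * FreeAlgebra.ι K (Sum.inl j))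
      (FreeAlgebra.ι K (Sum.inl j) * FreeAlgebra.ι K (Sum.inl i))
  | pp (i j : Fin n) : WeylAlgebra.Rel K n
      (FreeAlgebra.ι K (Sum.inr i) * FreeAlgebra.ι K (Sum.inr j))
      (FreeAlgebra.ι K (Sum.inr j) * FreeAlgebra.ι K (Sum.inr i))
  | pq (i j : Fin n) : WeylAlgebra.Rel K n
      (FreeAlgebra.ι K (Sum.inr i) * FreeAlgebra.ι K (Sum.inl j))
      (FreeAlgebra.ι K (Sum.inl j) * FreeAlgebra.ι K (Sum.inr i) + if i = j then 1 else 0)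

/-- The `n`-th Weyl algebra `Aₙ` over `K`: the `K`-algebra generated by
`q₁, …, qₙ, p₁, …, pₙ` subject to `[pᵢ, qⱼ] = δᵢⱼ`, `[pᵢ, pⱼ] = [qᵢ, qⱼ] = 0`. -/
abbrev WeylAlgebra (K : Type*) [CommRing K] (n : ℕ) : Type _ :=
  RingQuot (WeylAlgebra.Rel K n)

namespace WeylAlgebra

/-- The canonical generators of the Weyl algebra. -/
noncomputable def gen (K : Type*) [CommRing K] (n : ℕ) (i : Fin n ⊕ Fin n) : WeylAlgebra K n :=
  RingQuot.mkAlgHom K (Rel K n) (FreeAlgebra.ι K i)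

/-- The generator `qᵢ`. -/
noncomputable abbrev q (K : Type*) [CommRing K] {n : ℕ} (i : Fin n) : WeylAlgebra K n :=
  gen K n (Sum.inl i)

/-- The generator `pᵢ`. -/
noncomputable abbrev p (K : Type*) [CommRing K] {n : ℕ} (i : Fin n) : WeylAlgebra K n :=
  gen K n (Sum.inr i)

/-- The ordered monomial `q₁^α₁ ⋯ qₙ^αₙ p₁^β₁ ⋯ pₙ^βₙ`. -/
noncomputable def mono (K : Type*) [CommRing K] (n : ℕ) (e : (Fin n →₀ ℕ) × (Fin n →₀ ℕ)) :
    WeylAlgebra K n :=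
  (List.ofFn fun i => q K i ^ e.1 i).prod * (List.ofFn fun i => p K i ^ e.2 i).prod

section Basis

variable {K : Type*} [CommRing K] {n : ℕ}

theorem q_comm (i j : Fin n) : q K i * q K j = q K j * q K i := by
  simpa [gen] using RingQuot.mkAlgHom_rel K (Rel.qq (K := K) i j)

theorem p_comm (i j : Fin n) : p K i * p K j = p K j * p K i := by
  simpa [gen] using RingQuot.mkAlgHom_rel K (Rel.pp (K := K) i j)

theorem p_mul_q (i j : Fin n) :
    p K i * q K j = q K j * p K i + if i = j then 1 else 0 := by
  have h := RingQuot.mkAlgHom_rel K (Rel.pq (K := K) i j)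
  rw [map_mul, map_add, map_mul] at h
  rw [p, q, gen, gen, h]
  split_ifs <;> simp

/-- A pairwise commuting family defines an algebra homomorphism from the polynomial algebra. -/
theorem exists_algHom {W : Type*} [Ring W] [Algebra K W] (x : Fin n → W)
    (hx : ∀ i j, x i * x j = x j * x i) :
    ∃ f : MvPolynomial (Fin n) K →ₐ[K] W, ∀ i, f (MvPolynomial.X i) = x i := by
  have hc : IsMulCommutative (Algebra.adjoin K (Set.range x)) :=
    Algebra.isMulCommutative_adjoin K (by rintro _ ⟨i, rfl⟩ _ ⟨j, rfl⟩; exact hx i j)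
  let _ : CommRing (Algebra.adjoin K (Set.range x)) :=
    { (inferInstance : Ring (Algebra.adjoin K (Set.range x))) with
      mul_comm := hc.is_comm.comm }
  refine ⟨(Algebra.adjoin K (Set.range x)).val.comp
    (MvPolynomial.aeval fun i => ⟨x i, Algebra.subset_adjoin ⟨i, rfl⟩⟩), fun i => ?_⟩
  simp

theorem monomial_eq_prod_ofFn (a : Fin n →₀ ℕ) :
    MvPolynomial.monomial a (1 : K) =
      (List.ofFn fun i => (MvPolynomial.X i : MvPolynomial (Fin n) K) ^ a i).prod := by
  rw [List.prod_ofFn, MvPolynomial.monomial_eq, Finsupp.prod_fintype _ _ (by simp)]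
  simp

theorem algHom_monomial {W : Type*} [Ring W] [Algebra K W] (f : MvPolynomial (Fin n) K →ₐ[K] W)
    (a : Fin n →₀ ℕ) : f (MvPolynomial.monomial a 1) =
      (List.ofFn fun i => f (MvPolynomial.X i) ^ a i).prod := by
  rw [monomial_eq_prod_ofFn, map_list_prod, List.map_ofFn]
  simp [Function.comp_def]

/-- The action on polynomials in `2n` variables `X`, `Y` with `qᵢ` acting as multiplication by
`Xᵢ` and `pᵢ` as multiplication by `Yᵢ` plus `∂/∂Xᵢ`. -/
theorem exists_rep : ∃ r : WeylAlgebra K n →ₐ[K]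
      Module.End K (MvPolynomial (Fin n ⊕ Fin n) K),
    (∀ i h, r (q K i) h = MvPolynomial.X (Sum.inl i) * h) ∧
    (∀ i h, r (p K i) h = MvPolynomial.X (Sum.inr i) * h + MvPolynomial.pderiv (Sum.inl i) h) := by
  let g : FreeAlgebra K (Fin n ⊕ Fin n) →ₐ[K] Module.End K (MvPolynomial (Fin n ⊕ Fin n) K) :=
    FreeAlgebra.lift K (Sum.elim
      (fun i => LinearMap.mulLeft K (MvPolynomial.X (Sum.inl i)))
      (fun i => LinearMap.mulLeft K (MvPolynomial.X (Sum.inr i)) +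
        (MvPolynomial.pderiv (Sum.inl i)).toLinearMap))
  have hg : ∀ ⦃x y⦄, Rel K n x y → g x = g y := by
    intro x y h
    cases h with
    | qq i j =>
      refine LinearMap.ext fun h => ?_
      simp [g]; ring
    | pp i j =>
      have hd : ∀ h : MvPolynomial (Fin n ⊕ Fin n) K,
          MvPolynomial.pderiv (Sum.inl i) (MvPolynomial.pderiv (Sum.inl j) h) =
            MvPolynomial.pderiv (Sum.inl j) (MvPolynomial.pderiv (Sum.inl i) h) := by
        intro h
        have : ⁅MvPolynomial.pderiv (R := K) (Sum.inl i : Fin n ⊕ Fin n),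
            MvPolynomial.pderiv (R := K) (Sum.inl j : Fin n ⊕ Fin n)⁆ = 0 := by
          refine MvPolynomial.derivation_ext fun k => ?_
          classical
          simp only [Derivation.commutator_apply, MvPolynomial.pderiv_X, Pi.single_apply]
          split_ifs <;> simp
        have h2 := DFunLike.congr_fun this h
        rw [Derivation.commutator_apply] at h2
        exact sub_eq_zero.mp (by simpa using h2)
      refine LinearMap.ext fun h => ?_
      simp [g, hd]; ring
    | pq i j =>
      refine LinearMap.ext fun h => ?_
      classical
      by_cases hij : i = j
      · subst hij
        simp [g]; ring
      · have : (Sum.inl j : Fin n ⊕ Fin n) ≠ Sum.inl i := by simpa using Ne.symm hij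
        simp [g, hij, MvPolynomial.pderiv_X_of_ne this]; ring
  refine ⟨RingQuot.liftAlgHom K ⟨g, hg⟩, fun i h => ?_, fun i h => ?_⟩
  · simp [gen, g]
  · simp [gen, g]

theorem linearIndependent_mono : LinearIndependent K (mono K n) := by
  obtain ⟨r, hq, hp⟩ := exists_rep (K := K) (n := n)
  let ev : WeylAlgebra K n →ₗ[K] MvPolynomial (Fin n ⊕ Fin n) K :=
    (LinearMap.applyₗ (1 : MvPolynomial (Fin n ⊕ Fin n) K)).comp r.toLinearMap
  obtain ⟨f, hf⟩ := exists_algHom (K := K) (fun i : Fin n => q K i) q_comm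
  obtain ⟨g, hg⟩ := exists_algHom (K := K) (fun i : Fin n => p K i) p_comm
  have h1 : ∀ u h, r (f u) h = MvPolynomial.rename Sum.inl u * h := by
    intro u
    induction u using MvPolynomial.induction_on with
    | C a => intro h; simp [← MvPolynomial.algebraMap_eq, Algebra.smul_def]
    | add a b ha hb => intro h; simp [ha, hb, add_mul]
    | mul_X a i ha => intro h; simp [ha, hf, hq, mul_assoc]
  have h2 : ∀ v h, r (g v) (MvPolynomial.rename Sum.inr h) =
      MvPolynomial.rename Sum.inr (v * h) := by
    intro v
    induction v using MvPolynomial.induction_on with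
    | C a => intro h; simp [← MvPolynomial.algebraMap_eq, Algebra.smul_def]
    | add a b ha hb => intro h; simp [ha, hb, add_mul]
    | mul_X a i ha =>
      intro h
      have h0 : MvPolynomial.pderiv (Sum.inl i : Fin n ⊕ Fin n)
          (MvPolynomial.rename Sum.inr h : MvPolynomial (Fin n ⊕ Fin n) K) = 0 := by
        induction h using MvPolynomial.induction_on with
        | C a => simp
        | add a b ha hb => simp [ha, hb]
        | mul_X a j ha => simp [ha]
      have h3 := ha (MvPolynomial.X i * h)
      simp only [map_mul, MvPolynomial.rename_X] at h3
      simp [hg, hp, h0, h3, mul_assoc]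
  have hev : ∀ e, ev (mono K n e) = MvPolynomial.monomial
      (e.1.mapDomain Sum.inl + e.2.mapDomain Sum.inr) 1 := by
    intro e
    have : mono K n e = f (MvPolynomial.monomial e.1 1) * g (MvPolynomial.monomial e.2 1) := by
      simp [mono, algHom_monomial, hf, hg]
    have h3 := h2 (MvPolynomial.monomial e.2 1) 1
    rw [map_one (MvPolynomial.rename Sum.inr), mul_one] at h3
    rw [this]
    simp [ev, h1, h3, MvPolynomial.rename_monomial, MvPolynomial.monomial_mul]
  refine LinearIndependent.of_comp ev ?_
  have hinj : Function.Injective (fun e : (Fin n →₀ ℕ) × (Fin n →₀ ℕ) =>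
      (e.1.mapDomain Sum.inl + e.2.mapDomain Sum.inr : Fin n ⊕ Fin n →₀ ℕ)) := by
    rintro ⟨a, b⟩ ⟨c, d⟩ h
    simp only at h
    have hl : ∀ i, a i = c i := fun i => by
      have := DFunLike.congr_fun h (Sum.inl i)
      simpa [Finsupp.mapDomain_apply Sum.inl_injective, Finsupp.mapDomain_of_notMem_range] using this
    have hr : ∀ i, b i = d i := fun i => by
      have := DFunLike.congr_fun h (Sum.inr i)
      simpa [Finsupp.mapDomain_apply Sum.inr_injective, Finsupp.mapDomain_of_notMem_range] using this
    exact Prod.ext (Finsupp.ext hl) (Finsupp.ext hr)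
  have := (MvPolynomial.basisMonomials (Fin n ⊕ Fin n) K).linearIndependent.comp _ hinj
  have he : (ev ∘ mono K n) = (MvPolynomial.basisMonomials (Fin n ⊕ Fin n) K) ∘
      (fun e => e.1.mapDomain Sum.inl + e.2.mapDomain Sum.inr) := by
    funext e
    simp [hev]
  rw [he]
  exact this

theorem span_mono : ⊤ ≤ Submodule.span K (Set.range (mono K n)) := by
  obtain ⟨f, hf⟩ := exists_algHom (K := K) (fun i : Fin n => q K i) q_comm
  obtain ⟨g, hg⟩ := exists_algHom (K := K) (fun i : Fin n => p K i) p_comm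
  set S := Submodule.span K (Set.range (mono K n)) with hS
  have hmono : ∀ e, mono K n e =
      f (MvPolynomial.monomial e.1 1) * g (MvPolynomial.monomial e.2 1) := by
    intro e; simp [mono, algHom_monomial, hf, hg]
  have hfg : ∀ u v, f u * g v ∈ S := by
    intro u v
    induction u using MvPolynomial.induction_on' with
    | add a b ha hb => rw [map_add, add_mul]; exact S.add_mem ha hb
    | monomial a c =>
      induction v using MvPolynomial.induction_on' with
      | add x y hx hy => rw [map_add, mul_add]; exact S.add_mem hx hy
      | monomial b d =>
        have h1 : MvPolynomial.monomial a c = c • MvPolynomial.monomial a (1 : K) := by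
          simp [MvPolynomial.smul_monomial]
        have h2 : MvPolynomial.monomial b d = d • MvPolynomial.monomial b (1 : K) := by
          simp [MvPolynomial.smul_monomial]
        rw [h1, h2, map_smul, map_smul, smul_mul_smul_comm]
        exact S.smul_mem _ (Submodule.subset_span ⟨(a, b), hmono _⟩)
  have hpf : ∀ i u, p K i * f u = f u * p K i + f (MvPolynomial.pderiv i u) := by
    intro i u
    induction u using MvPolynomial.induction_on with
    | C a =>
      rw [← MvPolynomial.algebraMap_eq, AlgHom.commutes, ← Algebra.commutes]
      simp
    | add a b ha hb => simp only [map_add, mul_add, add_mul, ha, hb]; abel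
    | mul_X a j ha =>
      classical
      rw [map_mul, ← mul_assoc, ha, hf, add_mul, mul_assoc, p_mul_q, MvPolynomial.pderiv_mul,
        MvPolynomial.pderiv_X, map_add, map_mul, hf, Pi.single_apply]
      by_cases hij : i = j
      · subst hij
        simp [mul_add, mul_assoc]; abel
      · simp [hij, Ne.symm hij, mul_assoc]
  have hgen : ∀ k, ∀ s ∈ S, gen K n k * s ∈ S := by
    intro k s hs
    refine Submodule.span_induction ?_ ?_ ?_ ?_ hs
    · rintro _ ⟨e, rfl⟩
      rw [hmono]
      cases k with
      | inl i =>
        change q K i * _ ∈ S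
        rw [← hf i, ← mul_assoc, ← map_mul]
        exact hfg _ _
      | inr i =>
        change p K i * _ ∈ S
        rw [← mul_assoc, hpf, add_mul, mul_assoc, ← hg i, ← map_mul]
        exact S.add_mem (hfg _ _) (hfg _ _)
    · simp
    · intro x y _ _ hx hy; rw [mul_add]; exact S.add_mem hx hy
    · intro c x _ hx; rw [mul_smul_comm]; exact S.smul_mem c hx
  have hall : ∀ w : FreeAlgebra K (Fin n ⊕ Fin n), ∀ s ∈ S,
      RingQuot.mkAlgHom K (Rel K n) w * s ∈ S := by
    intro w
    induction w using FreeAlgebra.induction with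
    | grade0 c => intro s hs; rw [AlgHom.commutes, ← Algebra.smul_def]; exact S.smul_mem c hs
    | grade1 k => exact hgen k
    | mul a b ha hb => intro s hs; rw [map_mul, mul_assoc]; exact ha _ (hb s hs)
    | add a b ha hb => intro s hs; rw [map_add, add_mul]; exact S.add_mem (ha s hs) (hb s hs)
  intro a _
  obtain ⟨w, rfl⟩ := RingQuot.mkAlgHom_surjective K (Rel K n) a
  have h1 : (1 : WeylAlgebra K n) ∈ S := by simpa using hfg 1 1
  simpa using hall w 1 h1

end Basis

/-- The `K`-basis of the Weyl algebra formed by the ordered monomials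
`q₁^α₁ ⋯ qₙ^αₙ p₁^β₁ ⋯ pₙ^βₙ`. -/
noncomputable def basis (K : Type*) [CommRing K] (n : ℕ) :
    Module.Basis ((Fin n →₀ ℕ) × (Fin n →₀ ℕ)) K (WeylAlgebra K n) :=
  Module.Basis.mk linearIndependent_mono span_mono

end WeylAlgebra

/-- The algebra `Aₙ ⊗ Pₘ` over `K`, where `Aₙ` is the Weyl algebra and `Pₘ` is the polynomial
algebra in `m` variables. -/
abbrev WeylPoly (K : Type*) [CommRing K] (n m : ℕ) : Type _ :=
  WeylAlgebra K n ⊗[K] MvPolynomial (Fin m) K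

namespace WeylPoly

/-- The canonical generators `x₁, …, xₛ` of `Aₙ ⊗ Pₘ`, `s = 2n + m`: the elements `qᵢ ⊗ 1`,
`pᵢ ⊗ 1` and `1 ⊗ Xⱼ`. -/
noncomputable def gen (K : Type*) [CommRing K] (n m : ℕ) :
    (Fin n ⊕ Fin n) ⊕ Fin m → WeylPoly K n m :=
  Sum.elim (fun i => WeylAlgebra.gen K n i ⊗ₜ[K] 1) (fun j => 1 ⊗ₜ[K] MvPolynomial.X j)

/-- The `K`-basis of `Aₙ ⊗ Pₘ` formed by the ordered monomials `x^α` in the canonical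
generators; the multi-exponent is the triple of its `q`-, `p`- and polynomial parts. -/
noncomputable def basis (K : Type*) [CommRing K] (n m : ℕ) :
    Module.Basis (((Fin n →₀ ℕ) × (Fin n →₀ ℕ)) × (Fin m →₀ ℕ)) K (WeylPoly K n m) :=
  (WeylAlgebra.basis K n).tensorProduct (MvPolynomial.basisMonomials (Fin m) K)

/-- The total degree `|α| = α₁ + ⋯ + αₛ` of a multi-exponent. -/
def expDegree {n m : ℕ} (α : ((Fin n →₀ ℕ) × (Fin n →₀ ℕ)) × (Fin m →₀ ℕ)) : ℕ :=
  ∑ i, α.1.1 i + ∑ i, α.1.2 i + ∑ j, α.2 j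

/-- The degree of `a = ∑ λ_α x^α`: the maximum of `|α|` over all `α` with `λ_α ≠ 0`
(and `0` for `a = 0`). -/
noncomputable def degree {K : Type*} [CommRing K] {n m : ℕ} (a : WeylPoly K n m) : ℕ :=
  ((basis K n m).repr a).support.sup expDegree

/-- The degree of an automorphism `σ`: the maximum of the degrees of the `σ(xᵢ)`. -/
noncomputable def autDegree {K : Type*} [CommRing K] {n m : ℕ}
    (σ : WeylPoly K n m ≃ₐ[K] WeylPoly K n m) : ℕ :=
  Finset.univ.sup fun i => degree (σ (gen K n m i))

end WeylPoly

/-! Over a field, this is a growth argument. The generators commute up to scalars, so reordering a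
word changes it only by shorter words. Hence the map `symbol` to commutative polynomials is
multiplicative up to terms of lower degree, and `degLex` leading exponents add under multiplication
(`degLex_degree_symbol_mul`).

Let `σ` have degree at most `d`, and let `a = σ⁻¹(xⱼ)` have degree `e > 0` and leading exponent `λ`,
so `|λ| = e`. A basis monomial of degree `D` is only known to go to degree at most `d * D` under
`σ`, while `a`, of degree `e`, goes to degree at most 1. So one factor `x^λ` can be traded for `a ^
(d * e)` within the same bound on the image. Filling in the intermediate powers of `a` gives `d * e`
independent elements for each exponent of degree `< M`, all mapped to degree `< d * (M + e)`
(`card_expBelow_mul_le`). Both counts grow like `M ^ s / s!`, up to factors `d * e` and `d ^ s`, so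
`d * e ≤ d ^ s`.

Over a reduced ring, a nonzero coefficient of `σ⁻¹(xⱼ)` stays nonzero in the residue field of some
prime, and the field case applies after base change. -/

/-! ### Words in generators that commute up to scalars -/

/-- The `K`-span of the products of fewer than `k` members of the family `x`. -/
def wordSpan (K : Type*) {ι W : Type*} [CommRing K] [Ring W] [Algebra K W] (x : ι → W) (k : ℕ) :
    Submodule K W :=
  Submodule.span K {w | ∃ l : List ι, l.length < k ∧ (l.map x).prod = w}

/-- `b` consists of products of generators `x i`, one for each multi-exponent, and the
generators commute up to scalars. -/
structure IsOrderedMonomialBasis {K ι W : Type*} [CommRing K] [Ring W] [Algebra K W]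
    (x : ι → W) (b : Module.Basis (ι →₀ ℕ) K W) : Prop where
  comm : ∀ i j, ∃ c : K, x i * x j = x j * x i + algebraMap K W c
  word : ∀ α, ∃ l : List ι, (l : Multiset ι) = Finsupp.toMultiset α ∧ b α = (l.map x).prod

section WordSpan

variable {K ι W : Type*} [CommRing K] [Ring W] [Algebra K W] {x : ι → W}

theorem prod_mem_wordSpan {l : List ι} {k : ℕ} (h : l.length < k) :
    (l.map x).prod ∈ wordSpan K x k :=
  Submodule.subset_span ⟨l, h, rfl⟩

theorem wordSpan_mono {k l : ℕ} (h : k ≤ l) : wordSpan K x k ≤ wordSpan K x l :=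
  Submodule.span_mono fun _ ⟨t, ht, e⟩ => ⟨t, ht.trans_le h, e⟩

theorem mul_mem_wordSpan_succ (i : ι) {k : ℕ} {u : W} (hu : u ∈ wordSpan K x k) :
    x i * u ∈ wordSpan K x (k + 1) := by
  have : wordSpan K x k ≤ (wordSpan K x (k + 1)).comap (LinearMap.mulLeft K (x i)) := by
    refine Submodule.span_le.mpr ?_
    rintro _ ⟨l, hl, rfl⟩
    exact prod_mem_wordSpan (l := i :: l) (by simpa using hl)
  exact this hu

/-- An adjacent swap changes a word by a scalar times the word with those two letters removed, and
adjacent swaps generate all permutations. -/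
theorem prod_sub_prod_mem_wordSpan
    (hx : ∀ i j, ∃ c : K, x i * x j = x j * x i + algebraMap K W c)
    {l l' : List ι} (h : l.Perm l') :
    (l.map x).prod - (l'.map x).prod ∈ wordSpan K x l.length := by
  induction h with
  | nil => simp
  | cons i _ ih =>
    simp only [List.map_cons, List.prod_cons, List.length_cons, ← mul_sub]
    exact mul_mem_wordSpan_succ i ih
  | swap i j l =>
    obtain ⟨c, hc⟩ := hx j i
    have h1 : ((j :: i :: l).map x).prod - ((i :: j :: l).map x).prod = c • (l.map x).prod := by
      simp only [List.map_cons, List.prod_cons, ← mul_assoc, ← sub_mul, hc]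
      rw [add_sub_cancel_left, Algebra.smul_def]
    rw [h1]
    exact Submodule.smul_mem _ _ (prod_mem_wordSpan (by simp))
  | trans h1 _ ih1 ih2 =>
    rw [← sub_add_sub_cancel]
    exact add_mem ih1 (h1.length_eq ▸ ih2)

end WordSpan

/-! ### Symbols: comparison with commutative polynomials -/

namespace IsOrderedMonomialBasis

open MvPolynomial

variable {K ι W : Type*} [CommRing K] [Ring W] [Algebra K W] {x : ι → W}
  {b : Module.Basis (ι →₀ ℕ) K W}

theorem length_eq_degree {l : List ι} {α : ι →₀ ℕ}
    (h : (l : Multiset ι) = Finsupp.toMultiset α) : l.length = α.degree := by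
  rw [← Multiset.coe_card, h, Finsupp.card_toMultiset]
  rfl

/-- The linear identification with the commutative polynomials given by the basis. -/
noncomputable def symbol (b : Module.Basis (ι →₀ ℕ) K W) : W ≃ₗ[K] MvPolynomial ι K :=
  b.equiv (basisMonomials ι K) (Equiv.refl _)

theorem symbol_basis (α : ι →₀ ℕ) : symbol b (b α) = monomial α 1 := by
  simp [symbol]

theorem coeff_symbol (u : W) (α : ι →₀ ℕ) : (symbol b u).coeff α = b.repr u α := rfl

/-- The polynomials all of whose monomials have degree less than `k`. -/
noncomputable def lowDegree (K ι : Type*) [CommRing K] (k : ℕ) : Submodule K (MvPolynomial ι K) :=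
  restrictSupport K {γ | γ.degree < k}

theorem lowDegree_mono {k l : ℕ} (h : k ≤ l) : lowDegree K ι k ≤ lowDegree K ι l :=
  restrictSupport_mono K fun _ hγ => lt_of_lt_of_le hγ h

/-- Sorting a word into the basis monomial with the same letters leaves an error made of shorter
words, which induction on `k` controls. -/
theorem wordSpan_le (h : IsOrderedMonomialBasis x b) (k : ℕ) :
    wordSpan K x k ≤ (lowDegree K ι k).comap (symbol b).toLinearMap := by
  induction k with
  | zero => exact Submodule.span_le.mpr fun _ ⟨_, hl, _⟩ => absurd hl (Nat.not_lt_zero _)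
  | succ k ih =>
    classical
    refine Submodule.span_le.mpr ?_
    rintro _ ⟨l, hl, rfl⟩
    obtain ⟨α, hα⟩ := (Multiset.toFinsupp.symm).surjective (l : Multiset ι)
    obtain ⟨l', hl', hb⟩ := h.word α
    have hp : l.Perm l' := Multiset.coe_eq_coe.mp (hα.symm.trans hl'.symm)
    have h1 := prod_sub_prod_mem_wordSpan h.comm hp
    have h2 := ih (wordSpan_mono (Nat.lt_succ_iff.mp hl) h1)
    rw [← sub_add_cancel (l.map x).prod (l'.map x).prod]
    refine add_mem ?_ ?_
    · exact lowDegree_mono (Nat.le_succ k) h2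
    · change symbol b _ ∈ lowDegree K ι (k + 1)
      rw [← hb, symbol_basis, lowDegree, monomial_mem_restrictSupport]
      left
      change α.degree < k + 1
      rwa [← length_eq_degree hl', ← hp.length_eq]

theorem symbol_basis_mul (h : IsOrderedMonomialBasis x b) (α β : ι →₀ ℕ) :
    symbol b (b α * b β) - monomial (α + β) 1 ∈ lowDegree K ι (α.degree + β.degree) := by
  obtain ⟨l, hl, hbl⟩ := h.word α
  obtain ⟨l', hl', hbl'⟩ := h.word β
  obtain ⟨m, hm, hbm⟩ := h.word (α + β)
  have hp : (l ++ l').Perm m := Multiset.coe_eq_coe.mp (by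
    rw [hm, map_add, ← hl, ← hl', Multiset.coe_add])
  have h1 := h.wordSpan_le _ (prod_sub_prod_mem_wordSpan h.comm hp)
  rw [List.map_append, List.prod_append, ← hbl, ← hbl', ← hbm, List.length_append,
    length_eq_degree hl, length_eq_degree hl'] at h1
  rw [← symbol_basis (b := b), ← map_sub]
  exact h1

/-- Bilinear extension of `symbol_basis_mul`: noncommutativity is invisible in the top degree. -/
theorem symbol_mul (h : IsOrderedMonomialBasis x b) (u v : W) :
    symbol b (u * v) - symbol b u * symbol b v ∈
      lowDegree K ι ((symbol b u).totalDegree + (symbol b v).totalDegree) := by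
  have hu : ∀ u : W, u = ∑ α ∈ (symbol b u).support, (symbol b u).coeff α • b α := fun u => by
    refine (symbol b).injective ?_
    rw [map_sum]
    conv_lhs => rw [as_sum (symbol b u)]
    refine Finset.sum_congr rfl fun α _ => ?_
    rw [map_smul, symbol_basis, smul_monomial, smul_eq_mul, mul_one]
  have key : ∀ s t : Finset (ι →₀ ℕ), ∀ c d : (ι →₀ ℕ) → K, ∀ k l : ℕ,
      (∀ α ∈ s, α.degree ≤ k) → (∀ α ∈ t, α.degree ≤ l) →
      symbol b ((∑ α ∈ s, c α • b α) * ∑ β ∈ t, d β • b β) -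
        symbol b (∑ α ∈ s, c α • b α) * symbol b (∑ β ∈ t, d β • b β) ∈
        lowDegree K ι (k + l) := by
    intro s t c d k l hs ht
    simp only [map_sum, map_smul, Finset.sum_mul_sum, smul_mul_smul_comm, ← Finset.sum_sub_distrib,
      ← smul_sub]
    refine Submodule.sum_mem _ fun α hα => Submodule.sum_mem _ fun β hβ =>
      Submodule.smul_mem _ _ ?_
    rw [symbol_basis, symbol_basis, monomial_mul, mul_one]
    exact lowDegree_mono (add_le_add (hs α hα) (ht β hβ)) (h.symbol_basis_mul α β)
  have := key _ _ (fun α => (symbol b u).coeff α) (fun α => (symbol b v).coeff α) _ _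
    (fun α (hα : α ∈ (symbol b u).support) => le_totalDegree hα)
    (fun α (hα : α ∈ (symbol b v).support) => le_totalDegree hα)
  rwa [← hu, ← hu] at this

/-- Not strict: for `k = 0` the only such polynomial is `0`, of total degree `0`. -/
theorem totalDegree_le_of_mem {k : ℕ} {p : MvPolynomial ι K} (hp : p ∈ lowDegree K ι k) :
    p.totalDegree ≤ k :=
  Finset.sup_le fun _ hγ => le_of_lt ((mem_restrictSupport_iff K).mp hp hγ)

theorem totalDegree_symbol_mul_le (h : IsOrderedMonomialBasis x b) (u v : W) :
    (symbol b (u * v)).totalDegree ≤ (symbol b u).totalDegree + (symbol b v).totalDegree := by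
  rw [← sub_add_cancel (symbol b (u * v)) (symbol b u * symbol b v)]
  exact (totalDegree_add _ _).trans
    (max_le (totalDegree_le_of_mem (h.symbol_mul u v)) (totalDegree_mul _ _))

theorem basis_zero (h : IsOrderedMonomialBasis x b) : b 0 = 1 := by
  obtain ⟨l, hl, hb⟩ := h.word 0
  have : l = [] := by simpa using hl
  simpa [this] using hb

theorem basis_single (h : IsOrderedMonomialBasis x b) (i : ι) : b (Finsupp.single i 1) = x i := by
  obtain ⟨l, hl, hb⟩ := h.word (Finsupp.single i 1)
  have : l = [i] := by simpa using hl
  simpa [this] using hb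

theorem symbol_one (h : IsOrderedMonomialBasis x b) : symbol b 1 = 1 := by
  rw [← h.basis_zero, symbol_basis]
  rfl

theorem totalDegree_symbol_map_prod_le (h : IsOrderedMonomialBasis x b) (σ : W →ₐ[K] W) {d : ℕ}
    (hd : ∀ i, (symbol b (σ (x i))).totalDegree ≤ d) (l : List ι) :
    (symbol b (σ (l.map x).prod)).totalDegree ≤ d * l.length := by
  induction l with
  | nil => simp [h.symbol_one]
  | cons i l ih =>
    rw [List.map_cons, List.prod_cons, map_mul, List.length_cons, mul_add, mul_one, add_comm]
    exact (h.totalDegree_symbol_mul_le _ _).trans (add_le_add (hd i) ih)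

theorem totalDegree_symbol_map_basis_le (h : IsOrderedMonomialBasis x b) (σ : W →ₐ[K] W) {d : ℕ}
    (hd : ∀ i, (symbol b (σ (x i))).totalDegree ≤ d) (α : ι →₀ ℕ) :
    (symbol b (σ (b α))).totalDegree ≤ d * α.degree := by
  obtain ⟨l, hl, hb⟩ := h.word α
  rw [hb, ← length_eq_degree hl]
  exact h.totalDegree_symbol_map_prod_le σ hd l

theorem totalDegree_symbol_gen_pow_le (h : IsOrderedMonomialBasis x b) (j : ι) (k : ℕ) :
    (symbol b (x j ^ k)).totalDegree ≤ k := by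
  induction k with
  | zero => simp [h.symbol_one]
  | succ k ih =>
    rw [pow_succ]
    refine (h.totalDegree_symbol_mul_le _ _).trans (add_le_add ih ?_)
    rw [← h.basis_single, symbol_basis]
    exact (totalDegree_monomial_le _ _).trans (by simp)

end IsOrderedMonomialBasis

/-! ### Counting exponents and the asymptotic comparison -/

section Counting

/-- The multi-exponents of total degree less than `k`. -/
noncomputable def expBelow (ι : Type*) [Fintype ι] [DecidableEq ι] (k : ℕ) : Finset (ι →₀ ℕ) :=
  (Finset.range k).biUnion fun i => Finset.univ.finsuppAntidiag i

variable {ι : Type*} [Fintype ι] [DecidableEq ι]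

theorem mem_expBelow {k : ℕ} {α : ι →₀ ℕ} : α ∈ expBelow ι k ↔ α.degree < k := by
  simp [expBelow, Finset.mem_finsuppAntidiag, Finsupp.degree_eq_sum]

/-- Hockey-stick summation over the degrees `< k`. With no variables and `k = 0` the truncated
formula would give 1 instead of 0. -/
theorem card_expBelow (h : 1 ≤ Fintype.card ι) (k : ℕ) :
    (expBelow ι k).card = (k + Fintype.card ι - 1).choose (Fintype.card ι) := by
  rw [expBelow, Finset.card_biUnion]
  · simp only [Finset.card_finsuppAntidiag_nat_eq_multichoose, Finset.card_univ]
    obtain ⟨s, hs⟩ := Nat.exists_eq_add_of_le' h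
    rw [hs]
    cases k with
    | zero => simp
    | succ k =>
      rw [Nat.sum_range_multichoose]
      congr 1
      omega
  · intro i _ j _ hij
    rw [Function.onFun, Finset.disjoint_left]
    intro α h1 h2
    rw [Finset.mem_finsuppAntidiag] at h1 h2
    exact hij (h1.1.symm.trans h2.1)

/-- If `e d` times the number of multi-exponents of degree `< M` is at most the number of those
of degree `< d (M + e)` for all `M`, then `e ≤ d ^ (s - 1)`. -/
theorem le_pow_of_card_expBelow (h : 1 ≤ Fintype.card ι) {d e : ℕ} (hd : 0 < d)
    (H : ∀ M, d * e * (expBelow ι M).card ≤ (expBelow ι (d * (M + e))).card) :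
    e ≤ d ^ (Fintype.card ι - 1) := by
  set s := Fintype.card ι with hs
  -- The binomials are bounded by `M ^ s / s!` from below and by an `s`-th power over `s!` from
  -- above; the `s!` cancels.
  have h1 : ∀ M : ℕ, ((d * e : ℕ) : ℝ) * (M : ℝ) ^ s ≤ ((d * (M + e) + s : ℕ) : ℝ) ^ s := by
    intro M
    have hM : ((d * e : ℕ) : ℝ) * ((expBelow ι M).card : ℝ) ≤ (expBelow ι (d * (M + e))).card := by
      exact_mod_cast H M
    rw [card_expBelow h, card_expBelow h] at hM
    have h2 := Nat.pow_le_choose (α := ℝ) s (M + s - 1)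
    rw [show M + s - 1 + 1 - s = M by omega] at h2
    have h3 := Nat.choose_le_pow_div (α := ℝ) s (d * (M + e) + s - 1)
    have h4 : (0 : ℝ) < (s.factorial : ℝ) := by positivity
    have h5 : ((d * e : ℕ) : ℝ) * (M ^ s / s.factorial) ≤
        ((d * (M + e) + s - 1 : ℕ) : ℝ) ^ s / s.factorial :=
      (mul_le_mul_of_nonneg_left h2 (Nat.cast_nonneg _)).trans (hM.trans h3)
    rw [← mul_div_assoc, div_le_div_iff_of_pos_right h4] at h5
    refine h5.trans (pow_le_pow_left₀ (Nat.cast_nonneg _) ?_ _)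
    exact_mod_cast Nat.sub_le _ _
  -- Dividing by `M ^ s`, the right-hand side tends to `d ^ s`.
  have h2 : Filter.Tendsto (fun M : ℕ => ((d : ℝ) + ((d * e + s : ℕ) : ℝ) / M) ^ s) Filter.atTop
      (nhds ((d + 0 : ℝ) ^ s)) :=
    ((tendsto_const_nhds).add (tendsto_const_div_atTop_nhds_zero_nat _)).pow s
  have h3 : ((d * e : ℕ) : ℝ) ≤ ((d : ℝ) + 0) ^ s := by
    refine ge_of_tendsto h2 (Filter.eventually_atTop.mpr ⟨1, fun M hM => ?_⟩)
    have hM0 : (0 : ℝ) < M := by exact_mod_cast hM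
    have h4 := h1 M
    have h5 : ((d : ℝ) + ((d * e + s : ℕ) : ℝ) / M) ^ s * (M : ℝ) ^ s =
        ((d * (M + e) + s : ℕ) : ℝ) ^ s := by
      rw [← mul_pow]
      congr 1
      push_cast
      field_simp
      ring
    rw [← h5] at h4
    exact le_of_mul_le_mul_right h4 (by positivity)
  rw [add_zero] at h3
  have h4 : d * e ≤ d ^ s := by exact_mod_cast h3
  obtain ⟨t, ht⟩ := Nat.exists_eq_add_of_le' h
  rw [ht, pow_succ'] at h4
  rw [ht, Nat.add_sub_cancel]
  exact Nat.le_of_mul_le_mul_left h4 hd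

end Counting

/-! ### Division of exponents by a fixed exponent -/

section Multiples

variable {ι : Type*}

/-- Division with remainder by a nonzero multi-exponent. -/
theorem exists_eq_add_nsmul {lam : ι →₀ ℕ} (h : 0 < lam.degree) (ν : ι →₀ ℕ) :
    ∃ (μ : ι →₀ ℕ) (k : ℕ), ¬ lam ≤ μ ∧ ν = μ + k • lam := by
  induction hn : ν.degree using Nat.strong_induction_on generalizing ν with
  | _ n ih =>
    by_cases hl : lam ≤ ν
    · have h1 : ν - lam + lam = ν := tsub_add_cancel_of_le hl
      have h2 : (ν - lam).degree + lam.degree = n := by rw [← map_add, h1, hn]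
      obtain ⟨μ, k, hμ, hk⟩ := ih (ν - lam).degree (by omega) (ν - lam) rfl
      exact ⟨μ, k + 1, hμ, by rw [add_smul, one_smul, ← add_assoc, ← hk, h1]⟩
    · exact ⟨ν, 0, hl, by simp⟩

/-- If the multiplicities differed, the side with fewer copies of `lam` would have a remainder
containing `lam`. -/
theorem eq_of_add_nsmul_eq {lam μ μ' : ι →₀ ℕ} {i i' : ℕ} (h : ¬ lam ≤ μ)
    (h' : ¬ lam ≤ μ') (he : μ + i • lam = μ' + i' • lam) : μ = μ' ∧ i = i' := by
  have aux : ∀ {μ μ' : ι →₀ ℕ} {i i' : ℕ}, ¬ lam ≤ μ → μ + i • lam = μ' + i' • lam → i' ≤ i := by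
    intro μ μ' i i' hμ he
    by_contra hlt
    obtain ⟨k, rfl⟩ := Nat.exists_eq_add_of_lt (not_le.mp hlt)
    refine hμ ?_
    have h1 : μ = μ' + (k + 1) • lam := by
      refine add_right_cancel (b := i • lam) ?_
      rw [he, add_assoc μ', ← add_smul]
      congr 2
      ring
    rw [h1, add_smul, one_smul, ← add_assoc]
    exact le_add_self
  obtain rfl : i = i' := le_antisymm (aux h' he.symm) (aux h he)
  exact ⟨add_right_cancel he, rfl⟩

end Multiples

/-! ### Leading exponents -/

open MvPolynomial MonomialOrder

/-- In a linear relation, the largest leading monomial with nonzero coefficient has nothing to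
cancel against. -/
theorem MonomialOrder.linearIndependent_of_injective_degree {ι κ K : Type*} [Field K]
    (m : MonomialOrder ι) {f : κ → MvPolynomial ι K} (h0 : ∀ i, f i ≠ 0)
    (hf : Function.Injective fun i => m.degree (f i)) : LinearIndependent K f := by
  classical
  rw [linearIndependent_iff']
  intro s g hg
  by_contra! hne
  obtain ⟨i₀, hi₀, hgi₀⟩ := hne
  obtain ⟨i, hi, hmax⟩ := Finset.exists_max_image (s.filter fun i => g i ≠ 0)
    (fun i => m.toSyn (m.degree (f i))) ⟨i₀, Finset.mem_filter.mpr ⟨hi₀, hgi₀⟩⟩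
  rw [Finset.mem_filter] at hi
  have h1 := congrArg (coeff (m.degree (f i))) hg
  rw [coeff_sum, coeff_zero, Finset.sum_eq_single_of_mem i hi.1, coeff_smul, smul_eq_mul] at h1
  · exact (mul_ne_zero hi.2 (m.coeff_degree_ne_zero_iff.mpr (h0 i))) h1
  · intro j hj hji
    rw [coeff_smul, smul_eq_mul]
    by_cases hgj : g j = 0
    · rw [hgj, zero_mul]
    · have h2 := hmax j (Finset.mem_filter.mpr ⟨hj, hgj⟩)
      have h3 : m.toSyn (m.degree (f j)) ≠ m.toSyn (m.degree (f i)) := fun h =>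
        hji (hf (m.toSyn.injective h))
      rw [m.coeff_eq_zero_of_lt (lt_of_le_of_ne h2 h3), mul_zero]

namespace IsOrderedMonomialBasis

section LeadingMonomial

variable {K ι W : Type*} [Field K] [Ring W] [Algebra K W] {x : ι → W}
  {b : Module.Basis (ι →₀ ℕ) K W} [LinearOrder ι] [WellFoundedGT ι]

/-- The error in `symbol_mul` has smaller total degree than the product of the symbols, and `degLex`
compares total degrees first. So the leading term is that of the commutative product. -/
theorem degLex_degree_symbol_mul (h : IsOrderedMonomialBasis x b) {u v : W} (hu : u ≠ 0)
    (hv : v ≠ 0) : u * v ≠ 0 ∧ degLex.degree (symbol b (u * v)) =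
      degLex.degree (symbol b u) + degLex.degree (symbol b v) := by
  have hu' : symbol b u ≠ 0 := (symbol b).map_ne_zero_iff.mpr hu
  have hv' : symbol b v ≠ 0 := (symbol b).map_ne_zero_iff.mpr hv
  have hlow := h.symbol_mul u v
  set r := symbol b (u * v) - symbol b u * symbol b v with hr
  have he : symbol b (u * v) = symbol b u * symbol b v + r := by rw [hr, add_sub_cancel]
  have hdeg := degLex.degree_mul hu' hv'
  have hdd : (degLex.degree (symbol b u * symbol b v)).degree =
      (symbol b u).totalDegree + (symbol b v).totalDegree := by
    rw [hdeg, map_add, degree_degLexDegree, degree_degLexDegree]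
  have hc : coeff (degLex.degree (symbol b u * symbol b v)) r = 0 := by
    by_contra hne
    exact absurd ((mem_restrictSupport_iff K).mp hlow (mem_support_iff.mpr hne))
      (by simp [hdd])
  have hne : symbol b (u * v) ≠ 0 := by
    intro h0
    have h1 := congrArg (coeff (degLex.degree (symbol b u * symbol b v))) he
    rw [h0, coeff_add, hc, add_zero, coeff_zero] at h1
    exact degLex.coeff_degree_ne_zero_iff.mpr (mul_ne_zero hu' hv') h1.symm
  refine ⟨fun h0 => hne (by rw [h0, map_zero]), ?_⟩
  rw [← hdeg]
  -- The zero polynomial also has leading exponent `0`, so the strict comparison below could fail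
  -- for `r = 0`.
  by_cases hr0 : r = 0
  · rw [he, hr0, add_zero]
  rw [he]
  refine degLex.degree_add_of_lt ?_
  rw [degLex_lt_iff, Finsupp.DegLex.lt_iff]
  left
  change (degLex.degree r).degree < (degLex.degree (symbol b u * symbol b v)).degree
  rw [hdd]
  exact (mem_restrictSupport_iff K).mp hlow (degLex.degree_mem_support hr0)

theorem degLex_degree_symbol_pow (h : IsOrderedMonomialBasis x b) {a : W} (ha : a ≠ 0) (k : ℕ) :
    a ^ k ≠ 0 ∧ degLex.degree (symbol b (a ^ k)) = k • degLex.degree (symbol b a) := by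
  induction k with
  | zero =>
    have : Nontrivial W := ⟨a, 0, ha⟩
    simp [h.symbol_one]
  | succ k ih =>
    rw [pow_succ, add_smul, one_smul, ← ih.2]
    exact h.degLex_degree_symbol_mul ih.1 ha

end LeadingMonomial

/-! ### The growth inequality and the bound over a field -/

variable {K ι W : Type*} [Field K] [Ring W] [Algebra K W] {x : ι → W}
  {b : Module.Basis (ι →₀ ℕ) K W} [Fintype ι]

theorem card_le_of_linearIndependent [DecidableEq ι] {κ : Type*} [Fintype κ]
    {f : κ → MvPolynomial ι K} (hf : LinearIndependent K f) {k : ℕ}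
    (hk : ∀ i, f i ∈ lowDegree K ι k) : Fintype.card κ ≤ (expBelow ι k).card := by
  have hb := basisRestrictSupport K {γ : ι →₀ ℕ | γ.degree < k}
  have e : {γ : ι →₀ ℕ | γ.degree < k} ≃ expBelow ι k :=
    Equiv.subtypeEquivRight fun γ => mem_expBelow.symm
  have hb' := hb.reindex e
  have : Module.Finite K (lowDegree K ι k) := Module.Finite.of_basis hb'
  have h1 : Module.finrank K (lowDegree K ι k) = (expBelow ι k).card := by
    rw [lowDegree, Module.finrank_eq_card_basis hb', Fintype.card_coe]
  rw [← h1]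
  let g : κ → lowDegree K ι k := fun i => ⟨f i, hk i⟩
  have hg : LinearIndependent K g :=
    LinearIndependent.of_comp (lowDegree K ι k).subtype hf
  exact hg.fintype_card_le_finrank

theorem card_expBelow_mul_le [DecidableEq ι] (h : IsOrderedMonomialBasis x b) (σ : W ≃ₐ[K] W)
    {d e : ℕ} (hd : ∀ i, (symbol b (σ (x i))).totalDegree ≤ d) (j : ι)
    (he : (symbol b (σ.symm (x j))).totalDegree = e) (he0 : 0 < e) (hd0 : 0 < d) (M : ℕ) :
    d * e * (expBelow ι M).card ≤ (expBelow ι (d * (M + e))).card := by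
  classical
  -- Any linear order on the variables will do.
  let _ : LinearOrder ι := LinearOrder.lift' (Fintype.equivFin ι) (Fintype.equivFin ι).injective
  set a := σ.symm (x j) with ha
  have ha0 : a ≠ 0 := by
    intro h0
    rw [h0, map_zero, totalDegree_zero] at he
    omega
  have hx : σ a = x j := σ.apply_symm_apply _
  set lam := degLex.degree (symbol b a) with hlam
  have hle : lam.degree = e := by rw [hlam, degree_degLexDegree, he]
  choose μ k hμ hk using exists_eq_add_nsmul (lam := lam) (by omega)
  -- With `ν = μ + k • lam`, each copy of `lam` is traded for `a ^ (d * e)`, and `r < d * e` indexes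
  -- the extra powers.
  let f : expBelow ι M × Fin (d * e) → W := fun p => b (μ p.1) * a ^ (k p.1 * (d * e) + p.2)
  have hb0 : ∀ α, b α ≠ 0 := b.ne_zero
  have hf0 : ∀ p, f p ≠ 0 := fun p =>
    (h.degLex_degree_symbol_mul (hb0 _) (h.degLex_degree_symbol_pow ha0 _).1).1
  have hfd : ∀ p, degLex.degree (symbol b (f p)) = μ p.1 + (k p.1 * (d * e) + p.2 : ℕ) • lam :=
    fun p => by
      rw [(h.degLex_degree_symbol_mul (hb0 _) (h.degLex_degree_symbol_pow ha0 _).1).2,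
        (h.degLex_degree_symbol_pow ha0 _).2, symbol_basis, degree_monomial, if_neg one_ne_zero]
  have hinj : Function.Injective fun p => degLex.degree (symbol b (f p)) := by
    rintro ⟨ν, r⟩ ⟨ν', r'⟩ heq
    simp only [hfd] at heq
    obtain ⟨h1, h2⟩ := eq_of_add_nsmul_eq (hμ _) (hμ _) heq
    -- The exponent of `a` determines `r` and `k` as remainder and quotient modulo `d * e`.
    have hr : (r : ℕ) = r' := by
      have := congrArg (· % (d * e)) h2
      simpa [Nat.mul_add_mod', Nat.mod_eq_of_lt] using this
    have hkk : k ν = k ν' := by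
      rw [hr] at h2
      exact Nat.eq_of_mul_eq_mul_right (Nat.mul_pos hd0 he0) (Nat.add_right_cancel h2)
    refine Prod.ext (Subtype.ext ?_) (Fin.ext hr)
    change (ν : ι →₀ ℕ) = ν'
    rw [hk ν, hk ν', h1, hkk]
  have hli : LinearIndependent K fun p => symbol b (f p) :=
    degLex.linearIndependent_of_injective_degree
      (fun p => (symbol b).map_ne_zero_iff.mpr (hf0 p)) hinj
  have hli2 : LinearIndependent K fun p => symbol b (σ (f p)) := by
    have h1 := hli.map' (((symbol b).symm.trans σ.toLinearEquiv).trans (symbol b)).toLinearMap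
      (LinearEquiv.ker _)
    refine Eq.mp ?_ h1
    congr 1
    funext p
    simp
  have hmem : ∀ p, symbol b (σ (f p)) ∈ lowDegree K ι (d * (M + e)) := by
    rintro ⟨ν, r⟩
    -- Since `σ a = xⱼ`, each power of `a` costs only one degree here; the total is at most `d * |ν|
    -- + r`.
    have h1 : (symbol b (σ (f (ν, r)))).totalDegree ≤
        d * (μ ν).degree + (k ν * (d * e) + r) := by
      simp only [f, map_mul, map_pow, hx]
      exact (h.totalDegree_symbol_mul_le _ _).trans (add_le_add
        (h.totalDegree_symbol_map_basis_le σ.toAlgHom hd _) (h.totalDegree_symbol_gen_pow_le j _))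
    have h2 : (ν : ι →₀ ℕ).degree = (μ ν).degree + k ν * e := by
      conv_lhs => rw [hk ν]
      rw [map_add, map_nsmul, hle, smul_eq_mul]
    have h3 : (ν : ι →₀ ℕ).degree < M := mem_expBelow.mp ν.2
    have h4 : d * (μ ν).degree + (k ν * (d * e) + r) < d * (M + e) := by
      have h5 : d * (ν : ι →₀ ℕ).degree ≤ d * M := Nat.mul_le_mul_left _ h3.le
      have h6 := r.2
      rw [h2] at h5
      calc d * (μ ν).degree + (k ν * (d * e) + r)
          = d * ((μ ν).degree + k ν * e) + r := by ring
        _ < d * M + d * e := by omega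
        _ = d * (M + e) := by ring
    refine (mem_restrictSupport_iff K).mpr fun γ hγ => ?_
    exact ((le_totalDegree hγ).trans h1).trans_lt h4
  have := card_le_of_linearIndependent hli2 hmem
  rwa [Fintype.card_prod, Fintype.card_coe, Fintype.card_fin, mul_comm] at this

theorem totalDegree_symbol_symm_le (h : IsOrderedMonomialBasis x b) (hι : 1 ≤ Fintype.card ι)
    (σ : W ≃ₐ[K] W) {d : ℕ} (hd : ∀ i, (symbol b (σ (x i))).totalDegree ≤ d) (j : ι) :
    (symbol b (σ.symm (x j))).totalDegree ≤ d ^ (Fintype.card ι - 1) := by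
  classical
  -- If `d = 0`, then `σ (x j)` is a scalar, hence so is `x j`, contradicting independence of the
  -- basis elements `x j` and `1`.
  have hd0 : 0 < d := by
    by_contra hd0
    have h1 : (symbol b (σ (x j))).totalDegree = 0 := by have := hd j; omega
    rw [totalDegree_eq_zero_iff_eq_C] at h1
    set c := coeff 0 (symbol b (σ (x j)))
    have h2 : σ (x j) = c • 1 := by
      refine (symbol b).injective ?_
      rw [h1, map_smul, h.symbol_one, smul_eq_C_mul, mul_one]
    have h3 : x j = c • 1 := by
      refine σ.injective ?_
      rw [h2, map_smul, map_one]
    have h4 := congrArg (fun w => coeff (Finsupp.single j 1) (symbol b w)) h3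
    simp only [map_smul, h.symbol_one] at h4
    rw [← h.basis_single, symbol_basis, coeff_smul, coeff_monomial, coeff_one, if_pos rfl,
      if_neg (by simp [eq_comm])] at h4
    simp at h4
  obtain he0 | he0 := Nat.eq_zero_or_pos (symbol b (σ.symm (x j))).totalDegree
  · rw [he0]
    exact Nat.zero_le _
  · exact le_pow_of_card_expBelow hι hd0 fun M => h.card_expBelow_mul_le σ hd j rfl he0 hd0 M

end IsOrderedMonomialBasis

/-! ### Reduction from reduced rings to fields -/

namespace IsOrderedMonomialBasis

open MvPolynomial

variable {K ι W : Type*} [CommRing K] [Ring W] [Algebra K W] {x : ι → W}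
  {b : Module.Basis (ι →₀ ℕ) K W}

theorem baseChange (h : IsOrderedMonomialBasis x b) (L : Type*) [CommRing L] [Algebra K L] :
    IsOrderedMonomialBasis (fun i => (1 : L) ⊗ₜ[K] x i) (b.baseChange L) where
  comm i j := by
    obtain ⟨c, hc⟩ := h.comm i j
    refine ⟨algebraMap K L c, ?_⟩
    rw [Algebra.TensorProduct.tmul_mul_tmul, hc, Algebra.TensorProduct.tmul_mul_tmul,
      TensorProduct.tmul_add, Algebra.algebraMap_eq_smul_one c, TensorProduct.tmul_smul,
      TensorProduct.smul_tmul', Algebra.TensorProduct.algebraMap_apply,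
      Algebra.algebraMap_eq_smul_one c]
    simp
  word α := by
    obtain ⟨l, hl, hb⟩ := h.word α
    refine ⟨l, hl, ?_⟩
    have := map_list_prod (Algebra.TensorProduct.includeRight : W →ₐ[K] L ⊗[K] W) (l.map x)
    rw [← hb, List.map_map] at this
    rw [Module.Basis.baseChange_apply]
    exact this

/-- In a reduced ring the primes intersect in zero, so some prime misses `c`. -/
theorem exists_field_algebraMap_ne_zero {K : Type*} [CommRing K] [IsReduced K] {c : K}
    (hc : c ≠ 0) : ∃ (P : Ideal K) (_ : P.IsPrime), algebraMap K P.ResidueField c ≠ 0 := by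
  have h1 : c ∉ nilradical K := by
    rw [mem_nilradical]
    exact fun h => hc h.eq_zero
  rw [nilradical_eq_sInf, Ideal.mem_sInf] at h1
  push Not at h1
  obtain ⟨P, hP, hcP⟩ := h1
  have : P.IsPrime := hP
  exact ⟨P, hP, fun h => hcP (Ideal.algebraMap_residueField_eq_zero.mp h)⟩

/-- Coefficients after base change are images of the original ones: the bound `d` for `σ` persists,
and the prime is chosen so that the coefficient at `α` survives. -/
theorem degree_le_of_repr_symm_ne_zero [IsReduced K] [Fintype ι] (h : IsOrderedMonomialBasis x b)
    (hι : 1 ≤ Fintype.card ι) (σ : W ≃ₐ[K] W) {d : ℕ}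
    (hd : ∀ i α, b.repr (σ (x i)) α ≠ 0 → α.degree ≤ d) (j : ι) {α : ι →₀ ℕ}
    (hα : b.repr (σ.symm (x j)) α ≠ 0) : α.degree ≤ d ^ (Fintype.card ι - 1) := by
  obtain ⟨P, hP, hc⟩ := exists_field_algebraMap_ne_zero hα
  set L := P.ResidueField
  have hL := h.baseChange L
  let σL : L ⊗[K] W ≃ₐ[L] L ⊗[K] W := Algebra.TensorProduct.congr AlgEquiv.refl σ
  have h1 := hL.totalDegree_symbol_symm_le hι σL (d := d) (fun i => by
    refine Finset.sup_le fun β hβ => hd i β fun h0 => ?_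
    rw [mem_support_iff, coeff_symbol] at hβ
    refine hβ ?_
    simp [σL, h0]) j
  refine (le_totalDegree (mem_support_iff.mpr ?_)).trans h1
  rw [coeff_symbol]
  intro h0
  refine hc ?_
  rw [Algebra.algebraMap_eq_smul_one, ← Module.Basis.baseChange_repr_tmul, ← h0]
  simp [σL]

end IsOrderedMonomialBasis

/-! ### The ordered monomial basis of the Weyl–polynomial algebra -/

namespace WeylPoly

variable {K : Type*} [CommRing K] {n m : ℕ}

/-- Multi-exponents as triples and as functions on the index set of the generators. -/
noncomputable def expEquiv (n m : ℕ) : ((Fin n →₀ ℕ) × (Fin n →₀ ℕ)) × (Fin m →₀ ℕ) ≃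
    ((Fin n ⊕ Fin n) ⊕ Fin m →₀ ℕ) :=
  (Equiv.prodCongr Finsupp.sumFinsuppEquivProdFinsupp.symm (Equiv.refl _)).trans
    Finsupp.sumFinsuppEquivProdFinsupp.symm

theorem degree_expEquiv (α : ((Fin n →₀ ℕ) × (Fin n →₀ ℕ)) × (Fin m →₀ ℕ)) :
    (expEquiv n m α).degree = expDegree α := by
  simp [expEquiv, expDegree, Finsupp.degree_eq_sum, Fintype.sum_sum_type]

theorem gen_comm (i j : (Fin n ⊕ Fin n) ⊕ Fin m) : ∃ c : K,
    gen K n m i * gen K n m j = gen K n m j * gen K n m i + algebraMap K _ c := by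
  have hW : ∀ i j : Fin n ⊕ Fin n, ∃ c : K, WeylAlgebra.gen K n i * WeylAlgebra.gen K n j =
      WeylAlgebra.gen K n j * WeylAlgebra.gen K n i + algebraMap K _ c := by
    rintro (i | i) (j | j)
    · exact ⟨0, by rw [map_zero, add_zero]; exact WeylAlgebra.q_comm i j⟩
    · refine ⟨-(if j = i then 1 else 0), ?_⟩
      have := WeylAlgebra.p_mul_q (K := K) j i
      rw [this, map_neg]
      split_ifs <;> simp
    · refine ⟨if i = j then 1 else 0, ?_⟩
      have := WeylAlgebra.p_mul_q (K := K) i j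
      rw [this]
      split_ifs <;> simp
    · exact ⟨0, by rw [map_zero, add_zero]; exact WeylAlgebra.p_comm i j⟩
  rcases i with i | i <;> rcases j with j | j
  · obtain ⟨c, hc⟩ := hW i j
    refine ⟨c, ?_⟩
    simp only [gen, Sum.elim_inl, Algebra.TensorProduct.tmul_mul_tmul, hc,
      TensorProduct.add_tmul, mul_one, Algebra.TensorProduct.algebraMap_apply]
  all_goals exact ⟨0, by simp [gen, mul_comm]⟩

/-- The word `f 0, …, f 0, f 1, …, f 1, …` in which `f i` occurs `a i` times. -/
def powWord {k : ℕ} {ι : Type*} (f : Fin k → ι) (a : Fin k → ℕ) : List ι :=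
  (List.ofFn fun i => List.replicate (a i) (f i)).flatten

theorem prod_map_powWord {k : ℕ} {ι W : Type*} [Monoid W] (f : Fin k → ι) (a : Fin k → ℕ)
    (x : ι → W) : ((powWord f a).map x).prod = (List.ofFn fun i => x (f i) ^ a i).prod := by
  rw [powWord, List.map_flatten, List.prod_flatten, List.map_ofFn, List.map_ofFn]
  simp [Function.comp_def]

theorem coe_powWord {k : ℕ} {ι : Type*} (f : Fin k → ι) (a : Fin k → ℕ) :
    (powWord f a : Multiset ι) = ∑ i, a i • {f i} := by
  have h : ∀ L : List (List ι), (L.flatten : Multiset ι) =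
      (L.map fun l : List ι => (l : Multiset ι)).sum := by
    intro L
    induction L with
    | nil => rfl
    | cons l L ih => rw [List.flatten_cons, ← Multiset.coe_add, ih, List.map_cons, List.sum_cons]
  rw [powWord, h, List.map_ofFn, List.sum_ofFn]
  refine Finset.sum_congr rfl fun i _ => ?_
  rw [Function.comp_apply, Multiset.coe_replicate, Multiset.nsmul_singleton]

theorem isOrderedMonomialBasis :
    IsOrderedMonomialBasis (gen K n m) ((basis K n m).reindex (expEquiv n m)) where
  comm := gen_comm
  word α := by
    obtain ⟨⟨⟨a, a'⟩, c⟩, rfl⟩ := (expEquiv n m).surjective α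
    -- The letters appear in the order of the basis monomials: all `q`, then all `p`, then the
    -- polynomial variables.
    refine ⟨powWord (fun i => Sum.inl (Sum.inl i)) a ++ powWord (fun i => Sum.inl (Sum.inr i)) a' ++
      powWord Sum.inr c, ?_, ?_⟩
    · rw [← Multiset.coe_add, ← Multiset.coe_add, coe_powWord, coe_powWord, coe_powWord,
        Finsupp.toMultiset_apply, Finsupp.sum_fintype _ _ (by simp), Fintype.sum_sum_type,
        Fintype.sum_sum_type]
      simp [expEquiv]
    · rw [Module.Basis.reindex_apply, Equiv.symm_apply_apply, basis,
        Module.Basis.tensorProduct_apply, WeylAlgebra.basis, Module.Basis.mk_apply,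
        MvPolynomial.coe_basisMonomials, List.map_append, List.map_append, List.prod_append,
        List.prod_append, prod_map_powWord, prod_map_powWord, prod_map_powWord]
      have h1 : ∀ l : List (WeylAlgebra K n),
          ((l.map fun w => w ⊗ₜ[K] (1 : MvPolynomial (Fin m) K)).prod : WeylPoly K n m) =
            l.prod ⊗ₜ[K] 1 := fun l =>
        (map_list_prod (Algebra.TensorProduct.includeLeft :
          WeylAlgebra K n →ₐ[K] WeylPoly K n m) l).symm
      have h2 : ∀ l : List (MvPolynomial (Fin m) K),
          ((l.map fun w => (1 : WeylAlgebra K n) ⊗ₜ[K] w).prod : WeylPoly K n m) =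
            1 ⊗ₜ[K] l.prod := fun l =>
        (map_list_prod (Algebra.TensorProduct.includeRight :
          MvPolynomial (Fin m) K →ₐ[K] WeylPoly K n m) l).symm
      have e1 := h1 (List.ofFn fun i => WeylAlgebra.q K i ^ a i)
      have e2 := h1 (List.ofFn fun i => WeylAlgebra.p K i ^ a' i)
      have e3 := h2 (List.ofFn fun i => MvPolynomial.X i ^ c i)
      rw [List.map_ofFn] at e1 e2 e3
      simp only [gen, Sum.elim_inl, Sum.elim_inr, Algebra.TensorProduct.tmul_pow, one_pow]
      simp only [Function.comp_def] at e1 e2 e3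
      rw [e1, e2, e3, WeylAlgebra.monomial_eq_prod_ofFn]
      simp [WeylAlgebra.mono]

theorem degree_le_iff {a : WeylPoly K n m} {d : ℕ} : degree a ≤ d ↔
    ∀ α, ((basis K n m).reindex (expEquiv n m)).repr a α ≠ 0 → α.degree ≤ d := by
  rw [degree, Finset.sup_le_iff, (expEquiv n m).surjective.forall]
  simp [degree_expEquiv]

end WeylPoly

theorem corollary3p4 {K : Type*} [CommRing K] [Algebra ℚ K] [IsReduced K] (n m : ℕ)
    (hs : 1 ≤ 2 * n + m) (σ : WeylPoly K n m ≃ₐ[K] WeylPoly K n m) :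
    WeylPoly.autDegree σ.symm ≤ WeylPoly.autDegree σ ^ (2 * n + m - 1) := by
  have hcard : Fintype.card ((Fin n ⊕ Fin n) ⊕ Fin m) = 2 * n + m := by
    simp [two_mul]
  refine Finset.sup_le fun j _ => WeylPoly.degree_le_iff.mpr fun α hα => ?_
  rw [← hcard]
  exact WeylPoly.isOrderedMonomialBasis.degree_le_of_repr_symm_ne_zero (hcard ▸ hs) σ
    (fun i => WeylPoly.degree_le_iff.mp
      (Finset.le_sup (f := fun i => WeylPoly.degree (σ (WeylPoly.gen K n m i)))
        (Finset.mem_univ i))) j hα
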